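/- Let $\mathbb U_1$ be the bounded Urysohn space of diameter $1$, i.e. the (up to isometry unique) complete separable metric space of diameter $1$ which embeds every finite metric space of diameter at most $1$ isometrically and which is homogeneous, meaning that every isometry between finite subsets extends to an isometry of $\mathbb U_1$ onto itself. Let $G=\operatorname{Isom}(\mathbb U_1)$ be the group of isometries of $\mathbb U_1$ onto itself, let $g\in G$ and let $n\ge 1$ be an integer. If there is a point $a\in\mathbb U_1$ with $d(a,g(a))\ge 1/n$, then every element of $G$ can be written as a product of at most $n\cdot 2^9$ elements of $G$, each of which is a conjugate in $G$ of $g$ or of $g^{-1}$. -/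

import Mathlib

/-- `U` is the bounded Urysohn space of diameter `1`: a complete separable metric space of
diameter `1` which contains an isometric copy of every finite metric space of diameter at most `1`
and is homogeneous, that is, every isometry between finite subsets extends to an
isometry of `U` onto itself. These properties determine `U` up to isometry. -/
structure IsBoundedUrysohnSpace (U : Type*) [MetricSpace U] : Prop where
  complete : CompleteSpace U
  separable : TopologicalSpace.SeparableSpace U
  diam_eq_one : Metric.diam (Set.univ : Set U) = 1
  embeds_finite : ∀ (F : Type) [MetricSpace F] [Finite F],
    Metric.diam (Set.univ : Set F) ≤ 1 → ∃ φ : F → U, Isometry φ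
  homogeneous : ∀ s : Set U, s.Finite → ∀ φ : s → U, Isometry φ →
    ∃ h : U ≃ᵢ U, ∀ x : s, h x = φ x

/-- `f` is a product of at most `m` factors, each of which is a conjugate of `g` or of `g⁻¹`. -/
def IsProdOfAtMostConj {G : Type*} [Group G] (g : G) (m : ℕ) (f : G) : Prop :=
  ∃ l : List G, l.length ≤ m ∧ (∀ x ∈ l, IsConj g x ∨ IsConj g⁻¹ x) ∧ l.prod = f

/-! A product `k` of `n` conjugates of `g` moves a point by distance 1: join two points at distance
1 by a path of `n` steps of length `d(a, g a)` and let a conjugate of `g` make each step. It remains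
to write `f` as a product of 12 conjugates of `k` and `k⁻¹`, so that 12n factors suffice.

The tool is independence over a finite set `C`: distances are 1 or realized by a path through `C`.
Every finite set has a copy over `C` independent from a given set (`exists_sepBy`), and independence
together with the distances to `C` determines all the other distances (`SepBy.dist_eq`). Conjugating
`k` by an isometry that fixes a finite set, one can make it move a finite set by 1/2 up to paths
through the fixed set (`exists_displacing_conj`). In a product of three such conjugates along a
Markov sequence the halves add up to full independence (`exists_conj_sepBy`). Hence two such
products with a common end set can be adjusted to differ by a prescribed isometry on a finite set
(`IsMarkovChain.exists_conjChain_eq`).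

This solves `pairQuot k p = f * pairQuot k q` on finite sets. A back-and-forth that alternately
adjusts `p` and `q` stabilizes on a dense sequence, and completeness gives an exact solution. -/

open Filter Topology
open scoped Classical

section

/-! ### Extension and amalgamation of finite configurations. -/

variable {U : Type*} [MetricSpace U]

theorem IsBoundedUrysohnSpace.dist_le_one (hU : IsBoundedUrysohnSpace U) (x y : U) :
    dist x y ≤ 1 := by
  have hb : Bornology.IsBounded (Set.univ : Set U) := by
    -- `Metric.diam` takes the value 0 on unbounded sets, so diameter 1 forces boundedness.
    by_contra h
    have := Metric.diam_eq_zero_of_unbounded h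
    rw [hU.diam_eq_one] at this
    exact one_ne_zero this
  exact hU.diam_eq_one ▸ Metric.dist_le_diam_of_mem hb (Set.mem_univ x) (Set.mem_univ y)

/-- Two finite families with the same distances are exchanged by an isometry of `U`. -/
theorem IsBoundedUrysohnSpace.exists_map_eq (hU : IsBoundedUrysohnSpace U) {ι : Type*} [Finite ι]
    (u v : ι → U) (h : ∀ i j, dist (u i) (u j) = dist (v i) (v j)) :
    ∃ b : U ≃ᵢ U, ∀ i, b (u i) = v i := by
  have key : ∀ i j, u i = u j → v i = v j := fun i j hij => by
    rw [← dist_eq_zero, ← h, hij, dist_self]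
  let φ : Set.range u → U := fun x => v x.2.choose
  have hφ : ∀ i, φ ⟨u i, i, rfl⟩ = v i := fun i =>
    key _ _ (Set.mem_range_self (f := u) i).choose_spec
  obtain ⟨b, hb⟩ := hU.homogeneous (Set.range u) (Set.finite_range u) φ (by
    refine Isometry.of_dist_eq ?_
    rintro ⟨_, i, rfl⟩ ⟨_, j, rfl⟩
    rw [hφ, hφ, Subtype.dist_eq, h])
  exact ⟨b, fun i => by rw [← hφ i, ← hb]⟩

/-- A finite pseudometric space of diameter at most `1`, part of which is already realized in `U`,
can be realized in `U`. -/
theorem IsBoundedUrysohnSpace.exists_realization (hU : IsBoundedUrysohnSpace U)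
    {ι : Type*} [Finite ι] (δ : ι → ι → ℝ) (h0 : ∀ i, δ i i = 0) (hs : ∀ i j, δ i j = δ j i)
    (ht : ∀ i j k, δ i k ≤ δ i j + δ j k) (h1 : ∀ i j, δ i j ≤ 1) (s : Set ι) (φ : ι → U)
    (hφ : ∀ i ∈ s, ∀ j ∈ s, dist (φ i) (φ j) = δ i j) :
    ∃ ψ : ι → U, (∀ i j, dist (ψ i) (ψ j) = δ i j) ∧ ∀ i ∈ s, ψ i = φ i := by
  let pm : PseudoMetricSpace ι :=
    { dist := δ, dist_self := h0, dist_comm := hs, dist_triangle := ht }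
  -- `embeds_finite` accepts only metric spaces in `Type`: identify indices at distance 0 and shrink
  -- the universe.
  let Q := SeparationQuotient ι
  have : Finite Q := Quotient.finite _
  have : Small.{0} Q := Countable.toSmall _
  let e : Q ≃ Shrink.{0} Q := equivShrink.{0} Q
  let : MetricSpace (Shrink.{0} Q) := MetricSpace.induced e.symm e.symm.injective inferInstance
  have : Finite (Shrink.{0} Q) := Finite.of_equiv _ e
  have hd : ∀ i j : ι, dist (e (SeparationQuotient.mk i)) (e (SeparationQuotient.mk j)) = δ i j := by
    intro i j
    change dist (e.symm (e _)) (e.symm (e _)) = _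
    rw [e.symm_apply_apply, e.symm_apply_apply, SeparationQuotient.dist_mk]
    rfl
  obtain ⟨χ, hχ⟩ := hU.embeds_finite (Shrink.{0} Q) (by
    refine Metric.diam_le_of_forall_dist_le zero_le_one ?_
    intro x _ y _
    obtain ⟨x, rfl⟩ := e.surjective x
    obtain ⟨y, rfl⟩ := e.surjective y
    obtain ⟨x, rfl⟩ := SeparationQuotient.surjective_mk x
    obtain ⟨y, rfl⟩ := SeparationQuotient.surjective_mk y
    rw [hd]
    exact h1 _ _)
  obtain ⟨b, hb⟩ := hU.exists_map_eq (fun i : s => χ (e (SeparationQuotient.mk i.1)))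
    (fun i : s => φ i) (fun i j => by rw [hχ.dist_eq, hd, hφ _ i.2 _ j.2])
  exact ⟨fun i => b (χ (e (SeparationQuotient.mk i))),
    fun i j => by rw [b.isometry.dist_eq, hχ.dist_eq, hd], fun i hi => hb ⟨i, hi⟩⟩

/-- Amalgamation: a copy of the finite set `Z` at prescribed distances from the finite set `E`. -/
theorem IsBoundedUrysohnSpace.exists_dist_eq (hU : IsBoundedUrysohnSpace U) (Z E : Finset U)
    (r : U → U → ℝ) (hr1 : ∀ z ∈ Z, ∀ e ∈ E, r z e ≤ 1)
    (hE : ∀ z ∈ Z, ∀ e ∈ E, ∀ e' ∈ E, r z e ≤ r z e' + dist e e')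
    (hE' : ∀ z ∈ Z, ∀ e ∈ E, ∀ e' ∈ E, dist e e' ≤ r z e + r z e')
    (hZ : ∀ z ∈ Z, ∀ z' ∈ Z, ∀ e ∈ E, r z e ≤ r z' e + dist z z')
    (hZ' : ∀ z ∈ Z, ∀ z' ∈ Z, ∀ e ∈ E, dist z z' ≤ r z e + r z' e) :
    ∃ b : U ≃ᵢ U, ∀ z ∈ Z, ∀ e ∈ E, dist e (b z) = r z e := by
  let δ : E ⊕ Z → E ⊕ Z → ℝ := fun
    | .inl e, .inl e' => dist e e'
    | .inl e, .inr z => r z e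
    | .inr z, .inl e => r z e
    | .inr z, .inr z' => dist z z'
  obtain ⟨ψ, hψ, hψ'⟩ := hU.exists_realization δ
    (by rintro (x | x) <;> simp [δ])
    (by rintro (x | x) (y | y) <;> simp [δ, Subtype.dist_eq, dist_comm])
    (by
      rintro (⟨x, hx⟩ | ⟨x, hx⟩) (⟨y, hy⟩ | ⟨y, hy⟩) (⟨w, hw⟩ | ⟨w, hw⟩) <;>
        simp only [δ, Subtype.dist_eq]
      · exact dist_triangle _ _ _
      · linarith [hE w hw x hx y hy]
      · exact hE' y hy x hx w hw
      · linarith [hZ w hw y hy x hx, dist_comm w y]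
      · linarith [hE x hx w hw y hy, dist_comm w y]
      · exact hZ' x hx w hw y hy
      · linarith [hZ x hx y hy w hw]
      · exact dist_triangle _ _ _)
    (by
      rintro (⟨x, hx⟩ | ⟨x, hx⟩) (⟨y, hy⟩ | ⟨y, hy⟩) <;> simp only [δ, Subtype.dist_eq]
      · exact hU.dist_le_one _ _
      · exact hr1 _ hy _ hx
      · exact hr1 _ hx _ hy
      · exact hU.dist_le_one _ _)
    (Set.range Sum.inl) (fun i => i.elim Subtype.val Subtype.val)
    (by rintro _ ⟨x, rfl⟩ _ ⟨y, rfl⟩; rfl)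
  obtain ⟨b, hb⟩ := hU.exists_map_eq (fun z : Z => (z : U)) (fun z => ψ (.inr z))
    (fun i j => (hψ (.inr i) (.inr j)).symm)
  refine ⟨b, fun z hz e he => ?_⟩
  rw [hb ⟨z, hz⟩]
  have h1 := hψ' (.inl ⟨e, he⟩) ⟨_, rfl⟩
  have h2 := hψ (.inl ⟨e, he⟩) (.inr ⟨z, hz⟩)
  rw [h1] at h2
  exact h2

/-- A copy of `Z` all of whose points have distance at least `1 / 2` from `E`. -/
theorem IsBoundedUrysohnSpace.exists_dist_eq_of_half_le (hU : IsBoundedUrysohnSpace U)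
    (Z E : Finset U) (r : U → U → ℝ) (h0 : ∀ z e, 0 ≤ r z e)
    (hE : ∀ z e e', r z e ≤ r z e' + dist e e')
    (hZ : ∀ z z' e, r z e ≤ r z' e + dist z z') :
    ∃ b : U ≃ᵢ U, ∀ z ∈ Z, ∀ e ∈ E, dist e (b z) = min 1 (1 / 2 + r z e) := by
  -- Two new distances add up to at least 1, which bounds every old distance.
  have hh : ∀ z e, 1 / 2 ≤ min 1 (1 / 2 + r z e) := fun z e =>
    le_min (by norm_num) (by linarith [h0 z e])
  have hm : ∀ {x y t : ℝ}, 0 ≤ t → x ≤ y + t → min 1 (1 / 2 + x) ≤ min 1 (1 / 2 + y) + t := by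
    intro x y t h0t h
    rcases min_cases (1 : ℝ) (1 / 2 + y) with h' | h' <;>
      rcases min_cases (1 : ℝ) (1 / 2 + x) with h'' | h'' <;> linarith
  refine hU.exists_dist_eq Z E (fun z e => min 1 (1 / 2 + r z e)) (fun _ _ _ _ => min_le_left _ _)
    (fun z _ e _ e' _ => hm dist_nonneg (hE _ _ _))
    (fun z _ e _ e' _ => by linarith [hh z e, hh z e', hU.dist_le_one e e'])
    (fun z _ z' _ e _ => hm dist_nonneg (hZ _ _ _))
    (fun z _ z' _ e _ => by linarith [hh z e, hh z' e, hU.dist_le_one z z'])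

/-! ### Independence over a finite set. -/

/-- The distance from `x` to `y` is at least `r`, unless it is attained by a path through `C`.
For `r = 1` this says that `x` and `y` are independent over `C`. -/
def SepBy (r : ℝ) (C : Finset U) (x y : U) : Prop :=
  r ≤ dist x y ∨ ∃ c ∈ C, dist x c + dist c y ≤ dist x y

/-- Every finite set `S` can be moved over `C` to a position independent from `E`. -/
theorem IsBoundedUrysohnSpace.exists_sepBy (hU : IsBoundedUrysohnSpace U) (C S E : Finset U) :
    ∃ b : U ≃ᵢ U, (∀ c ∈ C, b c = c) ∧ ∀ s ∈ S, ∀ e ∈ E, SepBy 1 C e (b s) := by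
  -- The free amalgam over `C`: shortest paths through `C`, truncated at 1.
  let r : U → U → ℝ := fun z e => C.fold min 1 (fun c => dist e c + dist c z)
  have hr1 : ∀ z e, r z e ≤ 1 := fun z e => Finset.fold_min_le _ |>.2 (Or.inl le_rfl)
  have hrc : ∀ z e, ∀ c ∈ C, r z e ≤ dist e c + dist c z := fun z e c hc =>
    (Finset.fold_min_le _).2 (Or.inr ⟨c, hc, le_rfl⟩)
  have hrv : ∀ z e, r z e = 1 ∨ ∃ c ∈ C, dist e c + dist c z ≤ r z e := fun z e => by
    rcases (Finset.fold_min_le _).1 (le_refl (r z e)) with h | h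
    · exact Or.inl (le_antisymm (hr1 _ _) h)
    · exact Or.inr h
  obtain ⟨b, hb⟩ := hU.exists_dist_eq (S ∪ C) (E ∪ C) r (fun z _ e _ => hr1 z e)
    (fun z _ e _ e' _ => by
      rcases hrv z e' with h | ⟨c, hc, h⟩
      · linarith [hr1 z e, dist_nonneg (x := e) (y := e')]
      · linarith [hrc z e c hc, dist_triangle e e' c])
    (fun z _ e _ e' _ => by
      rcases hrv z e' with h | ⟨c, hc, h⟩ <;> rcases hrv z e with h' | ⟨c', hc', h'⟩
      · linarith [hU.dist_le_one e e']
      · linarith [hU.dist_le_one e e', dist_nonneg (x := e) (y := c'),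
          dist_nonneg (x := c') (y := z)]
      · linarith [hU.dist_le_one e e', dist_nonneg (x := e') (y := c),
          dist_nonneg (x := c) (y := z)]
      · linarith [dist_triangle4 e c' z e', dist_triangle e' c z, dist_comm e' z])
    (fun z _ z' _ e _ => by
      rcases hrv z' e with h | ⟨c, hc, h⟩
      · linarith [hr1 z e, dist_nonneg (x := z) (y := z')]
      · linarith [hrc z e c hc, dist_triangle c z' z, dist_comm z z'])
    (fun z _ z' _ e _ => by
      rcases hrv z e with h | ⟨c, hc, h⟩ <;> rcases hrv z' e with h' | ⟨c', hc', h'⟩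
      · linarith [hU.dist_le_one z z']
      · linarith [hU.dist_le_one z z', dist_nonneg (x := e) (y := c'),
          dist_nonneg (x := c') (y := z')]
      · linarith [hU.dist_le_one z z', dist_nonneg (x := e) (y := c),
          dist_nonneg (x := c) (y := z)]
      · linarith [dist_triangle4 z c e z', dist_triangle e c' z', dist_comm z c, dist_comm c e])
  refine ⟨b, fun c hc => ?_, fun s hs e he => ?_⟩
  -- `C` was put on both sides of the amalgam, where `r c c = 0` forces `b` to fix `c`.
  · have h1 := hb c (Finset.mem_union_right _ hc) c (Finset.mem_union_right _ hc)
    have h2 := hrc c c c hc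
    rw [dist_self, add_zero, ← h1] at h2
    exact (dist_le_zero.1 h2).symm
  · have h1 := hb s (Finset.mem_union_left _ hs) e (Finset.mem_union_left _ he)
    have hbc : ∀ c ∈ C, dist c (b s) ≤ dist c s := fun c hc => by
      rw [hb s (Finset.mem_union_left _ hs) c (Finset.mem_union_right _ hc)]
      simpa using hrc s c c hc
    rcases hrv s e with h | ⟨c, hc, h⟩
    · exact Or.inl (by rw [h1, h])
    · exact Or.inr ⟨c, hc, by linarith [hbc c hc]⟩

/-! ### Finite sets displaced by conjugates. -/

theorem IsometryEquiv.dist_inv_left (k : U ≃ᵢ U) (x y : U) : dist (k⁻¹ x) y = dist x (k y) := by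
  rw [← k.isometry.dist_eq, IsometryEquiv.apply_inv_self]

/-- If `k` moves some point by distance `1`, then every finite set has a copy at distance at least
`1 / 2` from a given finite set which is moved by at least `1 / 2`. -/
theorem IsBoundedUrysohnSpace.exists_half_displaced (hU : IsBoundedUrysohnSpace U) (k : U ≃ᵢ U)
    {a : U} (ha : 1 ≤ dist a (k a)) (Z E : Finset U) :
    ∃ b : U ≃ᵢ U, (∀ z ∈ Z, ∀ e ∈ E, 1 / 2 ≤ dist e (b z)) ∧
      ∀ z ∈ Z, ∀ z' ∈ Z, 1 / 2 ≤ dist (b z) (k (b z')) := by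
  -- The copy lies at distance 1/2 from `a` and hence at distance 1 from `k a`, while its image
  -- under `k` lies at distance 1/2 from `k a`.
  obtain ⟨b, hb⟩ := hU.exists_dist_eq_of_half_le Z (E ∪ {a, k a})
    (fun _ e => dist a e) (fun _ _ => dist_nonneg)
    (fun _ e e' => by linarith [dist_triangle a e' e, dist_comm e e'])
    (fun _ _ _ => le_add_of_nonneg_right dist_nonneg)
  refine ⟨b, fun z hz e he => ?_, fun z hz z' hz' => ?_⟩
  · rw [hb z hz e (Finset.mem_union_left _ he)]
    exact le_min (by norm_num) (by linarith [dist_nonneg (x := a) (y := e)])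
  · have h1 := hb z hz (k a) (by simp)
    have h2 := hb z' hz' a (by simp)
    rw [min_eq_left (by linarith)] at h1
    rw [dist_self, add_zero, min_eq_right (by norm_num)] at h2
    have h3 := k.isometry.dist_eq a (b z')
    linarith [dist_triangle (k a) (k (b z')) (b z), dist_comm (b z) (k (b z'))]

/-- If `k` moves some point by distance `1`, then every finite set has a copy over `F` which is
moved far away by `k`. -/
theorem IsBoundedUrysohnSpace.exists_displaced_copy (hU : IsBoundedUrysohnSpace U) (k : U ≃ᵢ U)
    {a : U} (ha : 1 ≤ dist a (k a)) (F Z : Finset U) :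
    ∃ t : U ≃ᵢ U, (∀ x ∈ F, t x = x) ∧ (∀ x ∈ F, ∀ z ∈ Z, SepBy 1 F (k⁻¹ x) (t z)) ∧
      ∀ z ∈ Z, ∀ z' ∈ Z, 1 / 2 ≤ dist (t z) (k (t z')) ∨
        ∃ x ∈ F, dist (t z) x + dist x (k (t z')) ≤ dist (t z) (k (t z')) := by
  have hk := k.dist_inv_left
  have aux : ∀ {s : ℝ}, 0 ≤ s → 1 / 2 ≤ min 1 (1 / 2 + s) := fun h =>
    le_min (by norm_num) (by linarith)
  obtain ⟨p, hpF, hp⟩ := hU.exists_sepBy F Z (F.image (k⁻¹ : U ≃ᵢ U))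
  set Y := Z.image p with hY
  obtain ⟨β, hβ, hkβ⟩ := hU.exists_half_displaced k ha Y
    (Y.image (k⁻¹ : U ≃ᵢ U) ∪ F.image (k⁻¹ : U ≃ᵢ U))
  -- `γ z` lies within 1/2 of both `z` and `β z`, so `γ` inherits displacement from `β` while
  -- staying close to `Y`.
  obtain ⟨γ, hγ⟩ := hU.exists_dist_eq_of_half_le Y
    (Y ∪ Y.image β ∪ (Y.image β).image k ∪ F.image (k⁻¹ : U ≃ᵢ U))
    (fun z e => min (dist (β z) e) (dist z e)) (fun _ _ => le_min dist_nonneg dist_nonneg)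
    (fun z e e' => by
      rw [← min_add_add_right, dist_comm e e']
      exact min_le_min (dist_triangle _ _ _) (dist_triangle _ _ _))
    (fun z z' e => by
      rw [← min_add_add_right]
      have h := β.isometry.dist_eq z z'
      exact min_le_min (by linarith [dist_triangle (β z) (β z') e])
        (by linarith [dist_triangle z z' e]))
  have hγY : ∀ z ∈ Y, ∀ u ∈ Y, 1 / 2 ≤ dist u (γ z) := fun z hz u hu => by
    rw [hγ z hz u (by simp [hu])]
    exact aux (le_min dist_nonneg dist_nonneg)
  have hγself : ∀ z ∈ Y, dist z (γ z) ≤ 1 / 2 := fun z hz => by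
    rw [hγ z hz z (by simp [hz]), dist_self, min_eq_right dist_nonneg]
    exact (min_le_right _ _).trans (by norm_num)
  have hβγ : ∀ z ∈ Y, dist (β z) (γ z) ≤ 1 / 2 := fun z hz => by
    rw [hγ z hz (β z) (by simp [hz]), dist_self, min_eq_left dist_nonneg]
    exact (min_le_right _ _).trans (by norm_num)
  have hγF : ∀ z ∈ Y, ∀ x ∈ F, 1 ≤ dist (k⁻¹ x) (γ z) ∨
      1 / 2 + dist z (k⁻¹ x) ≤ dist (k⁻¹ x) (γ z) := fun z hz x hx => by
    rw [hγ z hz (k⁻¹ x) (by simp only [Finset.mem_union]; right; exact Finset.mem_image_of_mem _ hx)]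
    have h1 := hβ z hz (k⁻¹ x) (Finset.mem_union_right _ (Finset.mem_image_of_mem _ hx))
    rw [dist_comm] at h1
    rw [le_min_iff, le_min_iff]
    rcases le_total (dist (β z) (k⁻¹ x)) (dist z (k⁻¹ x)) with h | h
    · left; rw [min_eq_left h]; exact ⟨le_rfl, by linarith⟩
    · rw [min_eq_right h]
      by_cases h' : 1 ≤ 1 / 2 + dist z (k⁻¹ x)
      · exact Or.inl ⟨le_rfl, h'⟩
      · exact Or.inr ⟨by linarith, le_rfl⟩
  have hkγ : ∀ z ∈ Y, ∀ z' ∈ Y, 1 / 2 ≤ dist (γ z) (k (γ z')) := fun z hz z' hz' => by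
    have h1 := hγ z hz (k (β z')) (by
      simp only [Finset.mem_union]
      exact Or.inl (Or.inr (Finset.mem_image_of_mem _ (Finset.mem_image_of_mem _ hz'))))
    have h2 := hkβ z hz z' hz'
    have h3 := hβ z' hz' (k⁻¹ z) (Finset.mem_union_left _ (Finset.mem_image_of_mem _ hz))
    rw [hk] at h3
    rw [min_eq_left (by linarith [le_min h2 h3])] at h1
    have h4 := k.isometry.dist_eq (β z') (γ z')
    linarith [dist_triangle (k (β z')) (k (γ z')) (γ z), hβγ z' hz',
      dist_comm (γ z) (k (γ z'))]
  -- Move `Y` freely over `F` and its companion `γ Y`; the displacement of `γ Y` then passes to `b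
  -- Y`.
  obtain ⟨b, hbF, hb⟩ := hU.exists_sepBy (F ∪ Y.image γ) Y
    (F.image (k⁻¹ : U ≃ᵢ U) ∪ (Y.image γ).image k)
  have hbγ : ∀ z ∈ Y, ∀ u ∈ Y, dist (γ u) (b z) = dist z (γ u) := fun z hz u hu => by
    rw [dist_comm, ← b.isometry.dist_eq z (γ u),
      hbF (γ u) (Finset.mem_union_right _ (Finset.mem_image_of_mem _ hu))]
  have hbF' : ∀ x ∈ F, b x = x := fun x hx => hbF x (Finset.mem_union_left _ hx)
  have hpY : ∀ z ∈ Z, p z ∈ Y := fun z hz => Finset.mem_image_of_mem _ hz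
  refine ⟨b * p, fun x hx => ?_, fun x hx z hz => ?_, fun z hz z' hz' => ?_⟩
  · rw [IsometryEquiv.mul_apply, hpF x hx, hbF' x hx]
  · rw [IsometryEquiv.mul_apply]
    rcases hb (p z) (hpY z hz) (k⁻¹ x)
      (Finset.mem_union_left _ (Finset.mem_image_of_mem _ hx)) with h | ⟨c, hc, h⟩
    · exact Or.inl h
    rcases Finset.mem_union.1 hc with hc | hc
    · exact Or.inr ⟨c, hc, h⟩
    obtain ⟨u, hu, rfl⟩ := Finset.mem_image.1 hc
    left
    have h1 := hγY u hu (p z) (hpY z hz)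
    rw [hbγ _ (hpY z hz) u hu] at h
    rcases hγF u hu x hx with h2 | h2 <;> linarith [dist_nonneg (x := u) (y := k⁻¹ x)]
  · simp only [IsometryEquiv.mul_apply]
    have h4 := k.isometry.dist_eq (γ (p z')) (b (p z'))
    rw [hbγ _ (hpY z' hz') _ (hpY z' hz')] at h4
    have h5 := hγself _ (hpY z' hz')
    have h6 := dist_triangle (k (γ (p z'))) (k (b (p z'))) (b (p z))
    have h7 := dist_comm (k (b (p z'))) (b (p z))
    rcases hb (p z) (hpY z hz) (k (γ (p z'))) (Finset.mem_union_right _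
      (Finset.mem_image_of_mem _ (Finset.mem_image_of_mem _ (hpY z' hz')))) with h | ⟨c, hc, h⟩
    · left; linarith
    rcases Finset.mem_union.1 hc with hc | hc
    · have h1 := hγF _ (hpY z' hz') c hc
      rw [hk, dist_comm c] at h1
      have h8 := dist_nonneg (x := c) (y := b (p z))
      rcases h1 with h1 | h1
      · left; linarith
      have h9 := hp z' hz' _ (Finset.mem_image_of_mem _ hc)
      rcases h9 with h9 | ⟨y, hy, h9⟩
      · left; linarith [dist_comm (p z') (k⁻¹ c)]
      right
      -- The extra 1/2 in `h1` pays for replacing `k (γ (p z'))` by `k (b (p z'))`; the path through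
      -- `y` bounds the remaining distance.
      refine ⟨c, hc, ?_⟩
      have h10 := dist_triangle (k⁻¹ c) y (b (p z'))
      have h11 := b.isometry.dist_eq y (p z')
      rw [hbF' y hy] at h11
      rw [hk _ (b (p z'))] at h10
      linarith [dist_comm (p z') (k⁻¹ c), dist_comm c (b (p z))]
    · obtain ⟨u, hu, rfl⟩ := Finset.mem_image.1 hc
      left
      rw [hbγ _ (hpY z hz) u hu] at h
      linarith [hγY u hu (p z) (hpY z hz), hkγ u hu _ (hpY z' hz'),
        dist_comm (γ u) (k (γ (p z')))]

/-- If `k` moves some point by distance `1`, then a conjugate of `k` by an isometry fixing `F`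
moves `Z` far away. -/
theorem IsBoundedUrysohnSpace.exists_displacing_conj (hU : IsBoundedUrysohnSpace U) (k : U ≃ᵢ U)
    {a : U} (ha : 1 ≤ dist a (k a)) (F Z E : Finset U) :
    ∃ b : U ≃ᵢ U, (∀ x ∈ F, b x = x) ∧
      (∀ x ∈ F, ∀ z ∈ Z, 1 ≤ dist x ((b * k * b⁻¹) z) ∨ ∃ y ∈ F,
        dist x ((b * k * b⁻¹) y) + dist y z ≤ dist x ((b * k * b⁻¹) z)) ∧
      ∀ z ∈ Z, ∀ e ∈ E, SepBy 1 F e ((b * k * b⁻¹) z) ∨ ∃ u ∈ Z,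
        1 / 2 ≤ dist u ((b * k * b⁻¹) z) ∧
          dist e u + dist u ((b * k * b⁻¹) z) ≤ dist e ((b * k * b⁻¹) z) := by
  obtain ⟨t, htF, ht1, ht2⟩ := hU.exists_displaced_copy k ha F Z
  -- `t⁻¹` brings the displaced copy back to `Z`; `c` frees the images from `E` without moving `Z ∪
  -- F`.
  obtain ⟨c, hcF, hc⟩ := hU.exists_sepBy (Z ∪ F) (Z.image (t⁻¹ * k * t : U ≃ᵢ U)) E
  have hcinv : ∀ x ∈ Z ∪ F, c⁻¹ x = x := fun x hx => by
    rw [← c.injective.eq_iff, IsometryEquiv.apply_inv_self, hcF x hx]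
  have htinv : ∀ x ∈ F, t⁻¹ x = x := fun x hx => by
    rw [← t.injective.eq_iff, IsometryEquiv.apply_inv_self, htF x hx]
  have hb : ∀ x ∈ Z ∪ F, (c * t⁻¹ * k * (c * t⁻¹)⁻¹) x = c (t⁻¹ (k (t x))) := fun x hx => by
    simp only [mul_inv_rev, inv_inv, IsometryEquiv.mul_apply, hcinv x hx]
  have hd : ∀ x ∈ Z ∪ F, ∀ y ∈ Z ∪ F,
      dist x ((c * t⁻¹ * k * (c * t⁻¹)⁻¹) y) = dist (t x) (k (t y)) := fun x hx y hy => by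
    rw [hb y hy, ← c.dist_inv_left, hcinv x hx, ← t.isometry.dist_eq,
      IsometryEquiv.apply_inv_self]
  have hF : ∀ x ∈ F, x ∈ Z ∪ F := fun x hx => Finset.mem_union_right _ hx
  have hZ : ∀ x ∈ Z, x ∈ Z ∪ F := fun x hx => Finset.mem_union_left _ hx
  refine ⟨c * t⁻¹, fun x hx => ?_, fun x hx z hz => ?_, fun z hz e he => ?_⟩
  · rw [IsometryEquiv.mul_apply, htinv x hx, hcF x (hF x hx)]
  · rw [hd x (hF x hx) z (hZ z hz), htF x hx]
    rcases ht1 x hx z hz with h | ⟨y, hy, h⟩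
    · exact Or.inl (by rwa [k.dist_inv_left] at h)
    · refine Or.inr ⟨y, hy, ?_⟩
      rw [hd x (hF x hx) y (hF y hy), htF x hx, htF y hy, ← k.dist_inv_left, ← k.dist_inv_left,
        ← t.isometry.dist_eq y z, htF y hy]
      exact h
  · have h : SepBy 1 (Z ∪ F) e ((c * t⁻¹ * k * (c * t⁻¹)⁻¹) z) := by
      rw [hb z (hZ z hz)]
      exact hc _ (Finset.mem_image_of_mem _ hz) e he
    rcases h with h | ⟨u, hu, h⟩
    · exact Or.inl (Or.inl h)
    rcases Finset.mem_union.1 hu with hu | hu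
    · rcases ht2 u hu z hz with h' | ⟨x, hx, h'⟩
      · exact Or.inr ⟨u, hu, by rwa [hd u (hZ u hu) z (hZ z hz)], h⟩
      · refine Or.inl (Or.inr ⟨x, hx, ?_⟩)
        have h1 := hd x (hF x hx) z (hZ z hz)
        have h2 := t.isometry.dist_eq u x
        rw [htF x hx] at h1 h2
        rw [← hd u (hZ u hu) z (hZ z hz)] at h'
        linarith [dist_triangle e u x]
    · exact Or.inl (Or.inr ⟨u, hu, h⟩)

/-! ### Transitivity and stationarity of independence. -/

namespace SepBy

variable {r : ℝ} {C : Finset U} {x y e u w : U}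

theorem of_mem_right (h : y ∈ C) : SepBy r C x y := Or.inr ⟨y, h, by simp⟩

theorem of_le {s : ℝ} (h : SepBy r C x y) (hs : s ≤ r) : SepBy s C x y := h.imp_left hs.trans

theorem trans_left (h : SepBy r C e u) (hu : dist e u + dist u w ≤ dist e w) :
    SepBy r C e w := by
  rcases h with h | ⟨c, hc, h⟩
  · exact Or.inl (by linarith [dist_nonneg (x := u) (y := w)])
  · exact Or.inr ⟨c, hc, by linarith [dist_triangle c u w]⟩

theorem trans_right (h : SepBy r C u w) (hu : dist e u + dist u w ≤ dist e w) :
    SepBy r C e w := by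
  rcases h with h | ⟨c, hc, h⟩
  · exact Or.inl (by linarith [dist_nonneg (x := e) (y := u)])
  · exact Or.inr ⟨c, hc, by linarith [dist_triangle e u c]⟩

/-- Independence passes from `A` to its image `A'` under an isometry `k` that moves `z` far away
from `A ∪ A'`. -/
theorem of_image {A A' : Finset U} {k : U ≃ᵢ U} {z : U} (hr : r ≤ 1)
    (hA : ∀ y ∈ A, k y ∈ A') (hA' : ∀ y ∈ A', SepBy r A y z)
    (h : 1 ≤ dist u (k z) ∨ ∃ y ∈ A ∪ A', dist u (k y) + dist y z ≤ dist u (k z)) :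
    SepBy r A' u (k z) := by
  rcases h with h | ⟨y, hy, h⟩
  · exact Or.inl (hr.trans h)
  have hk := k.isometry.dist_eq
  rcases Finset.mem_union.1 hy with hy | hy
  · exact Or.inr ⟨k y, hA y hy, by rwa [hk]⟩
  rcases hA' y hy with h' | ⟨c, hc, h'⟩
  · exact Or.inl (by linarith [dist_nonneg (x := u) (y := k y)])
  · refine Or.inr ⟨k c, hA c hc, ?_⟩
    rw [hk c z]
    linarith [dist_triangle u (k y) (k c), hk y c]

/-- Stationarity: an independent point has the largest distance from `e` that its distances to `C`
and the diameter allow. -/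
theorem dist_eq (hU : IsBoundedUrysohnSpace U) {w' : U} (h : SepBy 1 C e w) (h' : SepBy 1 C e w')
    (hC : ∀ c ∈ C, dist c w = dist c w') : dist e w = dist e w' := by
  apply le_antisymm
  · rcases h' with h' | ⟨c, hc, h'⟩
    · exact (hU.dist_le_one _ _).trans h'
    · linarith [dist_triangle e c w, hC c hc]
  · rcases h with h | ⟨c, hc, h⟩
    · exact (hU.dist_le_one _ _).trans h
    · linarith [dist_triangle e c w', hC c hc]

end SepBy

/-! ### Independence from three conjugates. -/

/-- Over a sequence of sets `X₀, X₁, X₂, X₃` with the Markov property, conjugates of three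
isometries `kᵢ` that map `Xᵢ₋₁` to `Xᵢ` bring any finite set into a position independent over `X₃`
from any other. -/
theorem IsBoundedUrysohnSpace.exists_conj_sepBy (hU : IsBoundedUrysohnSpace U)
    {k₁ k₂ k₃ : U ≃ᵢ U} (h₁ : ∃ a, 1 ≤ dist a (k₁ a)) (h₂ : ∃ a, 1 ≤ dist a (k₂ a))
    (h₃ : ∃ a, 1 ≤ dist a (k₃ a)) {X₀ X₁ X₂ X₃ : Finset U}
    (hX₂ : ∀ x ∈ X₁, k₂ x ∈ X₂) (hX₃ : ∀ x ∈ X₂, k₃ x ∈ X₃)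
    (hs₁ : ∀ y ∈ X₂ ∪ X₃, ∀ x ∈ X₀, SepBy 1 X₁ y x) (hs₂ : ∀ y ∈ X₃, ∀ x ∈ X₁, SepBy 1 X₂ y x)
    (Z E : Finset U) :
    ∃ a₁ a₂ a₃ : U ≃ᵢ U, (∀ x ∈ X₀ ∪ X₁, a₁ x = x) ∧ (∀ x ∈ X₁ ∪ X₂, a₂ x = x) ∧
      (∀ x ∈ X₂ ∪ X₃, a₃ x = x) ∧ ∀ z ∈ Z, ∀ e ∈ E, SepBy 1 X₃ e
        ((a₃ * k₃ * a₃⁻¹ * (a₂ * k₂ * a₂⁻¹) * (a₁ * k₁ * a₁⁻¹)) z) := by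
  obtain ⟨p₁, hp₁⟩ := h₁
  obtain ⟨p₂, hp₂⟩ := h₂
  obtain ⟨p₃, hp₃⟩ := h₃
  have conj_mem : ∀ {a k : U ≃ᵢ U} {A B : Finset U}, (∀ x ∈ A ∪ B, a x = x) →
      (∀ x ∈ A, k x ∈ B) → ∀ x ∈ A, (a * k * a⁻¹) x ∈ B := by
    intro a k A B ha hk x hx
    have h1 : a⁻¹ x = x := by
      rw [← a.injective.eq_iff, IsometryEquiv.apply_inv_self, ha x (Finset.mem_union_left _ hx)]
    rw [IsometryEquiv.mul_apply, IsometryEquiv.mul_apply, h1,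
      ha _ (Finset.mem_union_right _ (hk x hx))]
    exact hk x hx
  obtain ⟨a₁, ha₁, -, hv₁⟩ := hU.exists_displacing_conj k₁ hp₁ (X₀ ∪ X₁) Z (X₂ ∪ X₃)
  set l₁ := a₁ * k₁ * a₁⁻¹
  have hs₁' : ∀ y ∈ X₂ ∪ X₃, ∀ x ∈ X₀ ∪ X₁, SepBy 1 X₁ y x := fun y hy x hx =>
    (Finset.mem_union.1 hx).elim (hs₁ y hy x) SepBy.of_mem_right
  have hs₂' : ∀ y ∈ X₃, ∀ x ∈ X₁ ∪ X₂, SepBy 1 X₂ y x := fun y hy x hx =>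
    (Finset.mem_union.1 hx).elim (hs₂ y hy x) SepBy.of_mem_right
  have H₁ : ∀ z ∈ Z.image l₁, ∀ e ∈ X₂ ∪ X₃, SepBy (1 / 2) X₁ e z := by
    intro w hw e he
    obtain ⟨z, hz, rfl⟩ := Finset.mem_image.1 hw
    rcases hv₁ z hz e he with (h | ⟨x, hx, h⟩) | ⟨u, -, hu, h⟩
    · exact Or.inl (by linarith)
    · exact ((hs₁' e he x hx).trans_left h).of_le (by norm_num)
    · exact Or.inl (by linarith [dist_nonneg (x := e) (y := u)])
  obtain ⟨a₂, ha₂, hi₂, hv₂⟩ := hU.exists_displacing_conj k₂ hp₂ (X₁ ∪ X₂) (Z.image l₁) (E ∪ X₃)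
  have hm₂ := conj_mem ha₂ hX₂
  set l₂ := a₂ * k₂ * a₂⁻¹
  have A₂ : ∀ z ∈ Z.image l₁, ∀ e ∈ E, SepBy (1 / 2) X₂ e (l₂ z) := by
    intro z hz e he
    rcases hv₂ z hz e (Finset.mem_union_left _ he) with (h | ⟨x, hx, h⟩) | ⟨u, -, hu, h⟩
    · exact Or.inl (by linarith)
    · exact (SepBy.of_image (by norm_num) hm₂ (fun y hy => H₁ z hz y (Finset.mem_union_left _ hy))
        (hi₂ x hx z hz)).trans_right h
    · exact Or.inl (by linarith [dist_nonneg (x := e) (y := u)])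
  have B₂ : ∀ z ∈ Z.image l₁, ∀ e ∈ X₃, SepBy 1 X₂ e (l₂ z) := by
    intro z hz e he
    rcases hv₂ z hz e (Finset.mem_union_right _ he) with (h | ⟨x, hx, h⟩) | ⟨u, hu, hu', h⟩
    · exact Or.inl h
    · exact (hs₂' e he x hx).trans_left h
    -- Two halves give distance 1; otherwise the path meets `X₁`, and the Markov property carries it
    -- through `X₂`.
    · rcases H₁ u hu e (Finset.mem_union_right _ he) with h' | ⟨c, hc, h'⟩
      · exact Or.inl (by linarith)
      · exact (hs₂ e he c hc).trans_left (by linarith [dist_triangle c u (l₂ z)])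
  obtain ⟨a₃, ha₃, hi₃, hv₃⟩ := hU.exists_displacing_conj k₃ hp₃ (X₂ ∪ X₃)
    ((Z.image l₁).image l₂) E
  have hm₃ := conj_mem ha₃ hX₃
  set l₃ := a₃ * k₃ * a₃⁻¹
  refine ⟨a₁, a₂, a₃, ha₁, ha₂, ha₃, fun z hz e he => ?_⟩
  have hz₁ := Finset.mem_image_of_mem l₁ hz
  have hz₂ := Finset.mem_image_of_mem l₂ hz₁
  change SepBy 1 X₃ e (l₃ (l₂ (l₁ z)))
  have A₃ : ∀ x ∈ X₂ ∪ X₃, SepBy 1 X₃ x (l₃ (l₂ (l₁ z))) := fun x hx =>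
    SepBy.of_image le_rfl hm₃ (B₂ _ hz₁) (hi₃ x hx _ hz₂)
  rcases hv₃ _ hz₂ e he with (h | ⟨x, hx, h⟩) | ⟨u, hu, hu', h⟩
  · exact Or.inl h
  · exact (A₃ x hx).trans_right h
  -- The 1/2 from `A₂` and the 1/2 from the third conjugate add up to 1.
  · obtain ⟨v, hv, rfl⟩ := Finset.mem_image.1 hu
    rcases A₂ v hv e he with h' | ⟨c, hc, h'⟩
    · exact Or.inl (by linarith)
    · exact (A₃ c (Finset.mem_union_left _ hc)).trans_right
        (by linarith [dist_triangle c (l₂ v) (l₃ (l₂ (l₁ z)))])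

/-! ### Chains of conjugates along Markov sequences. -/

/-- The `i`-th conjugate `hᵢ g hᵢ⁻¹`. -/
def conjAt (g : U ≃ᵢ U) (h : Fin 3 → U ≃ᵢ U) (i : Fin 3) : U ≃ᵢ U := h i * g * (h i)⁻¹

/-- The product of three conjugates of `g`. -/
def conjChain (g : U ≃ᵢ U) (h : Fin 3 → U ≃ᵢ U) : U ≃ᵢ U :=
  conjAt g h 2 * conjAt g h 1 * conjAt g h 0

/-- The conjugates of `g` by the `hᵢ` map the sets `Xᵢ` onto each other, and these sets have the
Markov property. -/
structure IsMarkovChain (g : U ≃ᵢ U) (h : Fin 3 → U ≃ᵢ U) (X : Fin 4 → Finset U) : Prop where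
  image_eq : ∀ i : Fin 3, (X i.castSucc).image (conjAt g h i) = X i.succ
  sepBy_one : ∀ y ∈ X 2 ∪ X 3, ∀ x ∈ X 0, SepBy 1 (X 1) y x
  sepBy_two : ∀ y ∈ X 3, ∀ x ∈ X 1, SepBy 1 (X 2) y x

variable {g : U ≃ᵢ U} {h a : Fin 3 → U ≃ᵢ U} {X : Fin 4 → Finset U}

theorem IsometryEquiv.inv_apply_of_apply_eq {b : U ≃ᵢ U} {x y : U} (hb : b x = y) :
    b⁻¹ y = x := by
  rw [← hb, IsometryEquiv.inv_apply_self]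

theorem conjAt_mul (g : U ≃ᵢ U) (a h : Fin 3 → U ≃ᵢ U) (i : Fin 3) :
    conjAt g (a * h) i = a i * conjAt g h i * (a i)⁻¹ := by
  simp only [conjAt, Pi.mul_apply]
  group

theorem conjAt_mul_apply {i : Fin 3} {x : U} (h₁ : a i x = x)
    (h₂ : a i (conjAt g h i x) = conjAt g h i x) : conjAt g (a * h) i x = conjAt g h i x := by
  rw [conjAt_mul, IsometryEquiv.mul_apply, IsometryEquiv.mul_apply,
    IsometryEquiv.inv_apply_of_apply_eq h₁, h₂]

theorem conjChain_apply (x : U) :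
    conjChain g h x = conjAt g h 2 (conjAt g h 1 (conjAt g h 0 x)) := rfl

theorem conjChain_const_mul (b : U ≃ᵢ U) :
    conjChain g (fun i => b * h i) = b * conjChain g h * b⁻¹ := by
  simp only [conjChain, conjAt]
  group

namespace IsMarkovChain

theorem conjAt_mem (hX : IsMarkovChain g h X) {i : Fin 3} {x : U} (hx : x ∈ X i.castSucc) :
    conjAt g h i x ∈ X i.succ := by
  rw [← hX.image_eq]
  exact Finset.mem_image_of_mem _ hx

theorem image_conjChain (hX : IsMarkovChain g h X) : (X 0).image (conjChain g h) = X 3 := by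
  have h0 := hX.image_eq 0
  have h1 := hX.image_eq 1
  have h2 := hX.image_eq 2
  change (X 0).image _ = X 1 at h0
  change (X 1).image _ = X 2 at h1
  change (X 2).image _ = X 3 at h2
  rw [← h2, ← h1, ← h0, Finset.image_image, Finset.image_image]
  rfl

theorem conjChain_mul_apply (hX : IsMarkovChain g h X)
    (ha : ∀ i, ∀ x ∈ X i.castSucc ∪ X i.succ, a i x = x) {x : U} (hx : x ∈ X 0) :
    conjChain g (a * h) x = conjChain g h x := by
  have h0 : ∀ i : Fin 3, ∀ x ∈ X i.castSucc, conjAt g (a * h) i x = conjAt g h i x :=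
    fun i x hx => conjAt_mul_apply (ha i x (Finset.mem_union_left _ hx))
      (ha i _ (Finset.mem_union_right _ (hX.conjAt_mem hx)))
  have h1 : conjAt g h 0 x ∈ X 1 := hX.conjAt_mem (i := 0) hx
  have h2 : conjAt g h 1 (conjAt g h 0 x) ∈ X 2 := hX.conjAt_mem (i := 1) h1
  rw [conjChain_apply, conjChain_apply, h0 0 x hx, h0 1 _ h1, h0 2 _ h2]

end IsMarkovChain

theorem exists_le_dist_conjAt (hg : ∃ a, 1 ≤ dist a (g a)) (i : Fin 3) :
    ∃ a, 1 ≤ dist a (conjAt g h i a) := by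
  obtain ⟨a, ha⟩ := hg
  refine ⟨h i a, ?_⟩
  simp only [conjAt, IsometryEquiv.mul_apply, IsometryEquiv.inv_apply_self]
  rwa [(h i).isometry.dist_eq]

theorem IsMarkovChain.exists_sepBy (hX : IsMarkovChain g h X) (hU : IsBoundedUrysohnSpace U)
    (hg : ∃ a, 1 ≤ dist a (g a)) (Z E : Finset U) :
    ∃ a : Fin 3 → U ≃ᵢ U, (∀ i, ∀ x ∈ X i.castSucc ∪ X i.succ, a i x = x) ∧
      ∀ z ∈ Z, ∀ e ∈ E, SepBy 1 (X 3) e (conjChain g (a * h) z) := by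
  obtain ⟨a₁, a₂, a₃, h₁, h₂, h₃, hs⟩ := hU.exists_conj_sepBy
    (exists_le_dist_conjAt (h := h) hg 0) (exists_le_dist_conjAt (h := h) hg 1)
    (exists_le_dist_conjAt (h := h) hg 2) (fun x hx => hX.conjAt_mem (i := 1) hx)
    (fun x hx => hX.conjAt_mem (i := 2) hx) hX.sepBy_one hX.sepBy_two Z E
  refine ⟨![a₁, a₂, a₃], ?_, ?_⟩
  · intro i
    fin_cases i
    · exact h₁
    · exact h₂
    · exact h₃
  · intro z hz e he
    simp only [conjChain, conjAt_mul]
    exact hs z hz e he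

/-- Without changing the `hᵢ` over a finite set `B`, one can reach the Markov property. -/
theorem IsBoundedUrysohnSpace.exists_isMarkovChain (hU : IsBoundedUrysohnSpace U) (g : U ≃ᵢ U)
    (h : Fin 3 → U ≃ᵢ U) {B T : Finset U} (hT₂ : ∀ b ∈ B, conjAt g h 2 b ∈ T)
    (hT₁ : ∀ b ∈ B, conjAt g h 2 (conjAt g h 1 b) ∈ T) :
    ∃ a : Fin 3 → U ≃ᵢ U, (∀ i, ∀ x ∈ B, a i x = x) ∧ ∃ X : Fin 4 → Finset U,
      IsMarkovChain g (a * h) X ∧ X 3 = T ∧ B ⊆ X 1 ∧ B ⊆ X 2 := by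
  -- The sequence is built backwards from `T`, so that two chains can share their end.
  set X₂ := T.image ((conjAt g h 2)⁻¹ : U ≃ᵢ U) with hX₂
  have hB₂ : B ⊆ X₂ := fun b hb => Finset.mem_image.2
    ⟨_, hT₂ b hb, IsometryEquiv.inv_apply_self _ _⟩
  obtain ⟨a₁, ha₁, hs₁⟩ := hU.exists_sepBy X₂ (X₂.image ((conjAt g h 1)⁻¹ : U ≃ᵢ U)) T
  set X₁ := (X₂.image ((conjAt g h 1)⁻¹ : U ≃ᵢ U)).image a₁ with hX₁
  have hB₁ : B ⊆ X₁ := fun b hb => Finset.mem_image.2 ⟨b, Finset.mem_image.2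
    ⟨conjAt g h 1 b, Finset.mem_image.2 ⟨_, hT₁ b hb, IsometryEquiv.inv_apply_self _ _⟩,
      IsometryEquiv.inv_apply_self _ _⟩, ha₁ b (hB₂ hb)⟩
  obtain ⟨a₀, ha₀, hs₀⟩ := hU.exists_sepBy X₁ (X₁.image ((conjAt g h 0)⁻¹ : U ≃ᵢ U)) (X₂ ∪ T)
  have himg : ∀ {b k : U ≃ᵢ U} {A : Finset U}, (∀ x ∈ A, b x = x) →
      ((A.image (k⁻¹ : U ≃ᵢ U)).image b).image (b * k * b⁻¹ : U ≃ᵢ U) = A := by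
    intro b k A hb
    rw [Finset.image_image, Finset.image_image]
    refine (Finset.image_congr fun x hx => ?_).trans Finset.image_id
    simp only [Function.comp_apply, IsometryEquiv.mul_apply, IsometryEquiv.inv_apply_self,
      IsometryEquiv.apply_inv_self, id]
    exact hb x hx
  refine ⟨![a₀, a₁, 1], ?_, ![(X₁.image ((conjAt g h 0)⁻¹ : U ≃ᵢ U)).image a₀, X₁, X₂, T],
    ⟨?_, ?_, ?_⟩, rfl, hB₁, hB₂⟩
  · intro i x hx
    fin_cases i
    · exact ha₀ x (hB₁ hx)
    · exact ha₁ x (hB₂ hx)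
    · rfl
  · intro i
    rw [conjAt_mul]
    fin_cases i
    · exact himg ha₀
    · exact himg ha₁
    · change X₂.image (1 * conjAt g h 2 * 1⁻¹ : U ≃ᵢ U) = T
      rw [one_mul, inv_one, mul_one, hX₂, Finset.image_image]
      refine (Finset.image_congr fun x hx => ?_).trans Finset.image_id
      simp
  · intro y hy x hx
    obtain ⟨x, hx', rfl⟩ := Finset.mem_image.1 hx
    exact hs₀ x hx' y hy
  · intro y hy x hx
    obtain ⟨x, hx', rfl⟩ := Finset.mem_image.1 hx
    exact hs₁ x hx' y hy

/-- Two chains of conjugates over Markov sequences with a common end can be changed over these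
sequences so that they differ by a prescribed isometry `σ` on a given finite set. -/
theorem IsMarkovChain.exists_conjChain_eq {α β : Fin 3 → U ≃ᵢ U} {Y : Fin 4 → Finset U}
    (hX : IsMarkovChain g α X) (hY : IsMarkovChain g β Y) (hU : IsBoundedUrysohnSpace U)
    (hg : ∃ a, 1 ≤ dist a (g a)) (hXY : X 3 = Y 3) {σ : U ≃ᵢ U}
    (hσ : ∀ x ∈ X 0, conjChain g β (σ x) = conjChain g α x) (Z : Finset U) :
    ∃ a b : Fin 3 → U ≃ᵢ U, (∀ i, ∀ x ∈ X i.castSucc ∪ X i.succ, a i x = x) ∧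
      (∀ i, ∀ x ∈ Y i.castSucc ∪ Y i.succ, b i x = x) ∧
      ∀ z ∈ Z, conjChain g (b * β) (σ z) = conjChain g (a * α) z := by
  set E := Z.image σ ∪ Finset.univ.biUnion Y with hE
  obtain ⟨a, ha, hsa⟩ := hX.exists_sepBy hU hg Z E
  obtain ⟨b, hb, hsb⟩ := hY.exists_sepBy hU hg (Z.image σ) E
  have hd : ∀ z ∈ Z, ∀ t ∈ X 3,
      dist t (conjChain g (b * β) (σ z)) = dist t (conjChain g (a * α) z) := by
    intro z hz t ht
    obtain ⟨x, hx, rfl⟩ := Finset.mem_image.1 (hX.image_conjChain ▸ ht)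
    have hx' : σ x ∈ Y 0 := by
      have h1 : conjChain g α x ∈ Y 3 := hXY ▸ ht
      rw [← hY.image_conjChain] at h1
      obtain ⟨y, hy, hxy⟩ := Finset.mem_image.1 h1
      rw [← hσ x hx, (conjChain g β).injective.eq_iff] at hxy
      exact hxy ▸ hy
    conv_rhs => rw [← hX.conjChain_mul_apply ha hx, (conjChain g (a * α)).isometry.dist_eq]
    rw [← hσ x hx, ← hY.conjChain_mul_apply hb hx', (conjChain g (b * β)).isometry.dist_eq,
      σ.isometry.dist_eq]
  have hd' : ∀ z ∈ Z, ∀ e ∈ E,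
      dist e (conjChain g (b * β) (σ z)) = dist e (conjChain g (a * α) z) := fun z hz e he =>
    SepBy.dist_eq hU (hXY ▸ hsb _ (Finset.mem_image_of_mem _ hz) e he) (hsa z hz e he) (hd z hz)
  -- By stationarity both images of `Z` have the same distances to `E`. As `c` fixes `σ Z` and the
  -- sets `Y i`, conjugating the second chain by `c` keeps the data over `Y` and makes the images
  -- equal.
  obtain ⟨c, hc⟩ := hU.exists_map_eq
    (Sum.elim (fun e : E => (e : U)) fun z : Z => conjChain g (b * β) (σ z))
    (Sum.elim (fun e : E => (e : U)) fun z : Z => conjChain g (a * α) z) (by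
      rintro (⟨x, hx⟩ | ⟨x, hx⟩) (⟨y, hy⟩ | ⟨y, hy⟩)
      · rfl
      · exact hd' y hy x hx
      · simpa only [Sum.elim_inl, Sum.elim_inr, dist_comm] using hd' x hx y hy
      · simp only [Sum.elim_inr, IsometryEquiv.dist_eq])
  have hcE : ∀ e ∈ E, c e = e := fun e he => hc (.inl ⟨e, he⟩)
  refine ⟨a, fun i => c * b i, ha, fun i x hx => ?_, fun z hz => ?_⟩
  · have hxE : x ∈ E := Finset.mem_union_right _ (Finset.mem_biUnion.2
      ((Finset.mem_union.1 hx).elim (fun h => ⟨_, Finset.mem_univ _, h⟩)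
        fun h => ⟨_, Finset.mem_univ _, h⟩))
    rw [IsometryEquiv.mul_apply, hb i x hx, hcE x hxE]
  · have h1 : (fun i => c * b i) * β = fun i => c * (b * β) i := by
      ext1 i
      simp only [Pi.mul_apply, mul_assoc]
    rw [h1, conjChain_const_mul, IsometryEquiv.mul_apply, IsometryEquiv.mul_apply,
      IsometryEquiv.inv_apply_of_apply_eq
        (hcE _ (Finset.mem_union_left _ (Finset.mem_image_of_mem _ hz)))]
    exact hc (.inr ⟨z, hz⟩)

/-! ### Back-and-forth for the equation on finite sets. -/

/-- The quotient of two products of three conjugates of `g`. -/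
def pairQuot (g : U ≃ᵢ U) (p : Fin 2 → Fin 3 → U ≃ᵢ U) : U ≃ᵢ U :=
  (conjChain g (p 1))⁻¹ * conjChain g (p 0)

/-- The equation `pairQuot g p = f * pairQuot g q` holds on the finite set `D`, and `p` can be
changed without moving the points of `D` or their images. -/
def IsApproxSolution (g : U ≃ᵢ U) (D : Finset U) (p q : Fin 2 → Fin 3 → U ≃ᵢ U)
    (f : U ≃ᵢ U) : Prop :=
  ∃ X : Fin 2 → Fin 4 → Finset U, (∀ j, IsMarkovChain g (p j) (X j)) ∧ X 0 3 = X 1 3 ∧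
    (∀ j i, ∀ x ∈ D, x ∈ X j (Fin.castSucc i) ∪ X j (Fin.succ i) ∧
      p j i x ∈ X j (Fin.castSucc i) ∪ X j (Fin.succ i)) ∧
    ∀ x ∈ D ∪ X 0 0, pairQuot g p x = f (pairQuot g q x)

/-- All isometries in `p` and `p'` and their inverses agree on `D`. -/
def AgreeOn (D : Finset U) (p p' : Fin 2 → Fin 3 → U ≃ᵢ U) : Prop :=
  ∀ j i, ∀ x ∈ D, p' j i x = p j i x ∧ (p' j i)⁻¹ x = (p j i)⁻¹ x

variable {g : U ≃ᵢ U} {D D' : Finset U} {p p' p'' q q' : Fin 2 → Fin 3 → U ≃ᵢ U} {f : U ≃ᵢ U}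

theorem AgreeOn.mono (h : AgreeOn D' p p') (hD : D ⊆ D') : AgreeOn D p p' :=
  fun j i x hx => h j i x (hD hx)

theorem AgreeOn.trans (h : AgreeOn D p p') (h' : AgreeOn D p' p'') : AgreeOn D p p'' :=
  fun j i x hx => ⟨(h' j i x hx).1.trans (h j i x hx).1, (h' j i x hx).2.trans (h j i x hx).2⟩

theorem AgreeOn.of_mul {a : Fin 2 → Fin 3 → U ≃ᵢ U} (h : ∀ j i, ∀ x ∈ D, a j i x = x)
    (h' : ∀ j i, ∀ x ∈ D, a j i (p j i x) = p j i x) : AgreeOn D p (a * p) := fun j i x hx =>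
  ⟨h' j i x hx, by
    simp only [Pi.mul_apply, mul_inv_rev, IsometryEquiv.mul_apply]
    rw [IsometryEquiv.inv_apply_of_apply_eq (h j i x hx)]⟩

theorem isApproxSolution_empty : IsApproxSolution g ∅ p q f :=
  ⟨fun _ _ => ∅, fun _ => ⟨fun _ => rfl, by simp, by simp⟩, rfl, by simp, by simp⟩

/-- The points through which a chain of three conjugates passes from the points of `S`. -/
noncomputable def chainOrbit (g : U ≃ᵢ U) (h : Fin 3 → U ≃ᵢ U) (S : Finset U) : Finset U :=
  S ∪ S.image (conjAt g h 0) ∪ S.image (conjAt g h 1 * conjAt g h 0 : U ≃ᵢ U) ∪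
    S.image (conjChain g h)

theorem conjChain_mul_apply_of_chainOrbit {h a : Fin 3 → U ≃ᵢ U} {S : Finset U}
    (ha : ∀ i, ∀ x ∈ chainOrbit g h S, a i x = x) {x : U} (hx : x ∈ S) :
    conjChain g (a * h) x = conjChain g h x := by
  have h0 : x ∈ chainOrbit g h S := by simp [chainOrbit, hx]
  have h1 : conjAt g h 0 x ∈ chainOrbit g h S := by
    simp only [chainOrbit, Finset.mem_union]
    exact Or.inl (Or.inl (Or.inr (Finset.mem_image_of_mem _ hx)))
  have h2 : conjAt g h 1 (conjAt g h 0 x) ∈ chainOrbit g h S := by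
    simp only [chainOrbit, Finset.mem_union]
    exact Or.inl (Or.inr (Finset.mem_image_of_mem (conjAt g h 1 * conjAt g h 0 : U ≃ᵢ U) hx))
  have h3 : conjAt g h 2 (conjAt g h 1 (conjAt g h 0 x)) ∈ chainOrbit g h S := by
    simp only [chainOrbit, Finset.mem_union]
    exact Or.inr (Finset.mem_image_of_mem (conjChain g h) hx)
  rw [conjChain_apply, conjChain_apply, conjAt_mul_apply (ha 0 _ h0) (ha 0 _ h1),
    conjAt_mul_apply (ha 1 _ h1) (ha 1 _ h2), conjAt_mul_apply (ha 2 _ h2) (ha 2 _ h3)]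

/-- `q` is altered to acquire Markov sequences through `D'`; `p` is then altered over its old
sequences to extend the equation. The roles of `p` and `q` are now exchanged, whence `f⁻¹`. -/
theorem IsApproxSolution.exists_next (hs : IsApproxSolution g D p q f)
    (hU : IsBoundedUrysohnSpace U) (hg : ∃ a, 1 ≤ dist a (g a)) (D' : Finset U) :
    ∃ p' q', IsApproxSolution g D' q' p' f⁻¹ ∧ AgreeOn D p p' ∧ AgreeOn D' q q' := by
  obtain ⟨X, hX, hX3, hXD, hXf⟩ := hs
  -- The two orbits keep `pairQuot g q` unchanged on `X 0 0`, where the old equation is needed to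
  -- extend it.
  set B := D' ∪ (Finset.univ.biUnion fun j => Finset.univ.biUnion fun i => D'.image (q j i)) ∪
    chainOrbit g (q 0) (X 0 0) ∪ chainOrbit g (q 1) ((X 0 0).image (pairQuot g q)) with hB
  set T := Finset.univ.biUnion fun j => B.image (conjAt g (q j) 2) ∪
    B.image (conjAt g (q j) 2 * conjAt g (q j) 1 : U ≃ᵢ U) with hT
  have hT₁ : ∀ j, ∀ b ∈ B, conjAt g (q j) 2 b ∈ T := fun j b hb => Finset.mem_biUnion.2
    ⟨j, Finset.mem_univ _, Finset.mem_union_left _ (Finset.mem_image_of_mem _ hb)⟩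
  have hT₂ : ∀ j, ∀ b ∈ B, conjAt g (q j) 2 (conjAt g (q j) 1 b) ∈ T := fun j b hb =>
    Finset.mem_biUnion.2 ⟨j, Finset.mem_univ _, Finset.mem_union_right _ (Finset.mem_image_of_mem
      (conjAt g (q j) 2 * conjAt g (q j) 1 : U ≃ᵢ U) hb)⟩
  choose c hcB Y hY hY3 hBY₁ hBY₂ using fun j =>
    hU.exists_isMarkovChain g (q j) (hT₁ j) (hT₂ j)
  have hBY : ∀ j i, ∀ x ∈ B, x ∈ Y j (Fin.castSucc i) ∪ Y j (Fin.succ i) := by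
    intro j i x hx
    fin_cases i
    · exact Finset.mem_union_right _ (hBY₁ j hx)
    · exact Finset.mem_union_right _ (hBY₂ j hx)
    · exact Finset.mem_union_left _ (hBY₂ j hx)
  have hD'B : ∀ x ∈ D', x ∈ B := fun x hx => by simp [hB, hx]
  have hqB : ∀ j i, ∀ x ∈ D', q j i x ∈ B := fun j i x hx => by
    simp only [hB, Finset.mem_union]
    exact Or.inl (Or.inl (Or.inr (Finset.mem_biUnion.2 ⟨j, Finset.mem_univ _,
      Finset.mem_biUnion.2 ⟨i, Finset.mem_univ _, Finset.mem_image_of_mem _ hx⟩⟩)))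
  have hqq : AgreeOn D' q (c * q) := AgreeOn.of_mul (fun j i x hx => hcB j i x (hD'B x hx))
    fun j i x hx => hcB j i _ (hqB j i x hx)
  have hquot : ∀ x ∈ X 0 0, pairQuot g (c * q) x = pairQuot g q x := by
    intro x hx
    have h0 : conjChain g (c 0 * q 0) x = conjChain g (q 0) x :=
      conjChain_mul_apply_of_chainOrbit (fun i y hy => hcB 0 i y (by
        simp only [hB, Finset.mem_union]
        exact Or.inl (Or.inr hy))) hx
    have h1 : conjChain g (c 1 * q 1) (pairQuot g q x) = conjChain g (q 1) (pairQuot g q x) :=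
      conjChain_mul_apply_of_chainOrbit (fun i y hy => hcB 1 i y (Finset.mem_union_right _ hy))
        (Finset.mem_image_of_mem _ hx)
    refine IsometryEquiv.inv_apply_of_apply_eq (h1.trans (Eq.trans ?_ h0.symm))
    exact IsometryEquiv.apply_inv_self _ _
  obtain ⟨a, b, ha, hb, hab⟩ := (hX 0).exists_conjChain_eq (hX 1) hU hg hX3
    (σ := f * pairQuot g (c * q)) (fun x hx => by
      rw [IsometryEquiv.mul_apply, hquot x hx, ← hXf x (Finset.mem_union_right _ hx)]
      exact IsometryEquiv.apply_inv_self _ _) (D' ∪ Y 0 0)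
  have hab' : ∀ j i, ∀ x ∈ X j (Fin.castSucc i) ∪ X j (Fin.succ i),
      (![a, b] : Fin 2 → Fin 3 → U ≃ᵢ U) j i x = x := by
    intro j i x hx
    fin_cases j
    · exact ha i x hx
    · exact hb i x hx
  refine ⟨![a, b] * p, c * q, ⟨Y, hY, (hY3 0).trans (hY3 1).symm, fun j i x hx =>
    ⟨hBY j i x (hD'B x hx), ?_⟩, fun x hx => ?_⟩, ?_, hqq⟩
  · rw [(hqq j i x hx).1]
    exact hBY j i _ (hqB j i x hx)
  · refine (IsometryEquiv.inv_apply_of_apply_eq ?_).symm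
    exact (IsometryEquiv.inv_apply_of_apply_eq (hab x hx)).symm
  · exact AgreeOn.of_mul (fun j i x hx => hab' j i x (hXD j i x hx).1)
      fun j i x hx => hab' j i _ (hXD j i x hx).2

theorem IsApproxSolution.exists_next_next (hs : IsApproxSolution g D p q f)
    (hU : IsBoundedUrysohnSpace U) (hg : ∃ a, 1 ≤ dist a (g a)) (hD : D ⊆ D') :
    ∃ p' q', IsApproxSolution g D' p' q' f ∧ AgreeOn D p p' ∧ AgreeOn D q q' := by
  obtain ⟨p₁, q₁, hs₁, hp₁, hq₁⟩ := hs.exists_next hU hg D'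
  obtain ⟨q₂, p₂, hs₂, hq₂, hp₂⟩ := hs₁.exists_next hU hg D'
  rw [inv_inv] at hs₂
  exact ⟨p₂, q₂, hs₂, hp₁.trans (hp₂.mono hD), (hq₁.trans hq₂).mono hD⟩

/-! ### Passage to the limit. -/

/-- Pointwise convergence of isometries. -/
def TendstoPointwise (u : ℕ → U ≃ᵢ U) (v : U ≃ᵢ U) : Prop :=
  ∀ x, Tendsto (fun n => u n x) atTop (𝓝 (v x))

namespace TendstoPointwise

variable {u u' : ℕ → U ≃ᵢ U} {v v' : U ≃ᵢ U}

theorem const (v : U ≃ᵢ U) : TendstoPointwise (fun _ => v) v := fun _ => tendsto_const_nhds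

theorem mul (h : TendstoPointwise u v) (h' : TendstoPointwise u' v') :
    TendstoPointwise (fun n => u n * u' n) (v * v') := by
  intro x
  rw [tendsto_iff_dist_tendsto_zero]
  have h1 := tendsto_iff_dist_tendsto_zero.1 (h (v' x))
  have h2 := tendsto_iff_dist_tendsto_zero.1 (h' x)
  refine squeeze_zero (fun _ => dist_nonneg) (fun n => ?_) (by simpa using h2.add h1)
  simp only [IsometryEquiv.mul_apply]
  rw [← (u n).isometry.dist_eq (u' n x)]
  exact dist_triangle _ _ _

theorem inv (h : TendstoPointwise u v) : TendstoPointwise (fun n => (u n)⁻¹) v⁻¹ := by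
  intro x
  have h1 := tendsto_iff_dist_tendsto_zero.1 (h (v⁻¹ x))
  rw [tendsto_iff_dist_tendsto_zero]
  refine h1.congr fun n => ?_
  rw [IsometryEquiv.dist_inv_left, IsometryEquiv.apply_inv_self, dist_comm]

theorem conjChain {u : ℕ → Fin 3 → U ≃ᵢ U} {v : Fin 3 → U ≃ᵢ U}
    (h : ∀ i, TendstoPointwise (fun n => u n i) (v i)) :
    TendstoPointwise (fun n => conjChain g (u n)) (conjChain g v) :=
  have h' : ∀ i, TendstoPointwise (fun n => conjAt g (u n) i) (conjAt g v i) := fun i =>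
    ((h i).mul (const g)).mul (h i).inv
  ((h' 2).mul (h' 1)).mul (h' 0)

theorem pairQuot {u : ℕ → Fin 2 → Fin 3 → U ≃ᵢ U} {v : Fin 2 → Fin 3 → U ≃ᵢ U}
    (h : ∀ j i, TendstoPointwise (fun n => u n j i) (v j i)) :
    TendstoPointwise (fun n => pairQuot g (u n)) (pairQuot g v) :=
  (conjChain (h 1)).inv.mul (conjChain (h 0))

end TendstoPointwise

/-- Isometries that are eventually constant at each point of a dense sequence converge at every
point. -/
theorem exists_tendsto_of_eventually_eq [CompleteSpace U] {d : ℕ → U} (hd : DenseRange d)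
    {u : ℕ → U ≃ᵢ U} (h : ∀ n, ∀ j ≤ n, u (n + 1) (d j) = u n (d j)) (x : U) :
    ∃ y, Tendsto (fun n => u n x) atTop (𝓝 y) := by
  have hc : ∀ j n, j ≤ n → u n (d j) = u j (d j) := fun j n hn => by
    induction n, hn using Nat.le_induction with
    | base => rfl
    | succ n hn ih => rw [h n j hn, ih]
  refine cauchySeq_tendsto_of_complete (Metric.cauchySeq_iff'.2 fun ε hε => ?_)
  obtain ⟨j, hj⟩ := hd.exists_dist_lt x (half_pos hε)
  refine ⟨j, fun n hn => ?_⟩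
  have h1 := (u n).isometry.dist_eq x (d j)
  have h2 := (u j).isometry.dist_eq x (d j)
  rw [hc j n hn] at h1
  linarith [dist_triangle_right (u n x) (u j x) (u j (d j))]

/-- The inverses must stabilize too: their limit is a right inverse, which makes the limit isometry
surjective. -/
theorem exists_tendstoPointwise [CompleteSpace U] {d : ℕ → U} (hd : DenseRange d)
    {u : ℕ → U ≃ᵢ U} (h : ∀ n, ∀ j ≤ n, u (n + 1) (d j) = u n (d j))
    (h' : ∀ n, ∀ j ≤ n, (u (n + 1))⁻¹ (d j) = (u n)⁻¹ (d j)) :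
    ∃ v, TendstoPointwise u v := by
  choose v hv using exists_tendsto_of_eventually_eq hd h
  choose w hw using exists_tendsto_of_eventually_eq hd (u := fun n => (u n)⁻¹) h'
  have hvi : ∀ x y, dist (v x) (v y) = dist x y := fun x y =>
    tendsto_nhds_unique ((hv x).dist (hv y)) (by simp [IsometryEquiv.dist_eq])
  have hvw : ∀ x, v (w x) = x := by
    intro x
    refine tendsto_nhds_unique (hv (w x)) (tendsto_iff_dist_tendsto_zero.2 ?_)
    refine (tendsto_iff_dist_tendsto_zero.1 (hw x)).congr fun n => ?_
    rw [IsometryEquiv.dist_inv_left, dist_comm]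
  exact ⟨IsometryEquiv.mk' v w hvw (Isometry.of_dist_eq hvi), hv⟩

theorem IsBoundedUrysohnSpace.exists_pairQuot_eq (hU : IsBoundedUrysohnSpace U)
    (hg : ∃ a, 1 ≤ dist a (g a)) (f : U ≃ᵢ U) :
    ∃ p q, pairQuot g p = f * pairQuot g q := by
  have := hU.complete
  have := hU.separable
  have : Nonempty U := hg.nonempty
  set d := TopologicalSpace.denseSeq U
  have hd : DenseRange d := TopologicalSpace.denseRange_denseSeq U
  let D : ℕ → Finset U := fun n => (Finset.range n).image d
  have hD : ∀ n, D n ⊆ D (n + 1) := fun n =>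
    Finset.image_subset_image (Finset.range_mono n.le_succ)
  have hdD : ∀ n, ∀ j < n, d j ∈ D n := fun n j hj =>
    Finset.mem_image_of_mem _ (Finset.mem_range.2 hj)
  let S : ℕ → Type _ := fun n => {s : (Fin 2 → Fin 3 → U ≃ᵢ U) × (Fin 2 → Fin 3 → U ≃ᵢ U) //
    IsApproxSolution g (D n) s.1 s.2 f}
  have hnext : ∀ n, ∀ s : S n, ∃ s' : S (n + 1), AgreeOn (D n) s.1.1 s'.1.1 ∧
      AgreeOn (D n) s.1.2 s'.1.2 := fun n s => by
    obtain ⟨p', q', h, hp, hq⟩ := s.2.exists_next_next hU hg (hD n)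
    exact ⟨⟨(p', q'), h⟩, hp, hq⟩
  choose next hnext using hnext
  let s : ∀ n, S n := fun n => Nat.rec ⟨(1, 1), isApproxSolution_empty⟩ next n
  have hlim : ∀ u : ℕ → Fin 2 → Fin 3 → U ≃ᵢ U, (∀ n, AgreeOn (D n) (u n) (u (n + 1))) →
      ∃ v : Fin 2 → Fin 3 → U ≃ᵢ U, ∀ j i, TendstoPointwise (fun n => u n j i) (v j i) := by
    intro u hu
    -- The shift is needed because `D n` contains only the `d j` with `j < n`.
    have h : ∀ j i, ∃ v, TendstoPointwise (fun n => u (n + 1) j i) v := fun j i =>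
      exists_tendstoPointwise hd
        (fun n k hk => (hu (n + 1) j i (d k) (hdD _ _ (Nat.lt_succ_of_le hk))).1)
        (fun n k hk => (hu (n + 1) j i (d k) (hdD _ _ (Nat.lt_succ_of_le hk))).2)
    choose v hv using h
    exact ⟨v, fun j i x => (tendsto_add_atTop_iff_nat 1).1 (hv j i x)⟩
  obtain ⟨p, hp⟩ := hlim (fun n => (s n).1.1) fun n => (hnext n (s n)).1
  obtain ⟨q, hq⟩ := hlim (fun n => (s n).1.2) fun n => (hnext n (s n)).2
  refine ⟨p, q, ?_⟩
  have hp' := TendstoPointwise.pairQuot (g := g) hp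
  have hq' := (TendstoPointwise.const f).mul (TendstoPointwise.pairQuot (g := g) hq)
  have heq : ∀ j, pairQuot g p (d j) = (f * pairQuot g q) (d j) := fun j => by
    refine tendsto_nhds_unique_of_eventuallyEq (hp' (d j)) (hq' (d j)) ?_
    filter_upwards [eventually_gt_atTop j] with n hn
    obtain ⟨X, -, -, -, h⟩ := (s n).2
    exact h (d j) (Finset.mem_union_left _ (hdD n j hn))
  exact DFunLike.coe_injective (hd.equalizer (pairQuot g p).continuous
    (f * pairQuot g q).continuous (funext heq))

/-! ### Counting conjugates. -/

namespace IsProdOfAtMostConj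

variable {G : Type*} [Group G] {g a b : G} {m m' : ℕ}

theorem mono (h : IsProdOfAtMostConj g m a) (hm : m ≤ m') : IsProdOfAtMostConj g m' a := by
  obtain ⟨l, hl, hc, hp⟩ := h
  exact ⟨l, hl.trans hm, hc, hp⟩

theorem mul (ha : IsProdOfAtMostConj g m a) (hb : IsProdOfAtMostConj g m' b) :
    IsProdOfAtMostConj g (m + m') (a * b) := by
  obtain ⟨l, hl, hc, rfl⟩ := ha
  obtain ⟨l', hl', hc', rfl⟩ := hb
  refine ⟨l ++ l', by simpa using add_le_add hl hl', fun x hx => ?_, List.prod_append⟩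
  exact (List.mem_append.1 hx).elim (hc x) (hc' x)

theorem inv (ha : IsProdOfAtMostConj g m a) : IsProdOfAtMostConj g m a⁻¹ := by
  obtain ⟨l, hl, hc, rfl⟩ := ha
  refine ⟨(l.map fun x => x⁻¹).reverse, by simpa using hl, fun x hx => ?_,
    (List.prod_inv_reverse l).symm⟩
  obtain ⟨y, hy, rfl⟩ := List.mem_map.1 (List.mem_reverse.1 hx)
  have hi : ∀ {u v : G}, IsConj u v → IsConj u⁻¹ v⁻¹ := fun {u v} h => by
    obtain ⟨c, rfl⟩ := isConj_iff.1 h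
    exact isConj_iff.2 ⟨c, by group⟩
  rcases hc y hy with h | h
  · exact Or.inr (hi h)
  · exact Or.inl (by simpa using hi h)

theorem conj (ha : IsProdOfAtMostConj g m a) (c : G) :
    IsProdOfAtMostConj g m (c * a * c⁻¹) := by
  obtain ⟨l, hl, hc, rfl⟩ := ha
  refine ⟨l.map (MulAut.conj c), by simpa using hl, fun x hx => ?_, ?_⟩
  · obtain ⟨y, hy, rfl⟩ := List.mem_map.1 hx
    have hy' : IsConj y (MulAut.conj c y) := isConj_iff.2 ⟨c, rfl⟩
    exact (hc y hy).imp (fun h => h.trans hy') fun h => h.trans hy'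
  · rw [← map_list_prod, MulAut.conj_apply]

end IsProdOfAtMostConj

theorem IsProdOfAtMostConj.pairQuot {g k : U ≃ᵢ U} {m : ℕ} (hk : IsProdOfAtMostConj g m k)
    (p : Fin 2 → Fin 3 → U ≃ᵢ U) : IsProdOfAtMostConj g (m + m + m + (m + m + m)) (pairQuot k p) :=
  have h : ∀ j, IsProdOfAtMostConj g (m + m + m) (conjChain k (p j)) := fun j =>
    ((hk.conj (p j 2)).mul (hk.conj (p j 1))).mul (hk.conj (p j 0))
  (h 1).inv.mul (h 0)

/-- The points `0, …, n` at distances `min 1 (δ |i - j|)` are realized in `U`. -/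
theorem IsBoundedUrysohnSpace.exists_arithmetic_path (hU : IsBoundedUrysohnSpace U) (a : U) {δ : ℝ}
    (hδ : 0 ≤ δ) (n : ℕ) : ∃ x : ℕ → U, ∀ i ≤ n, ∀ j ≤ n,
      dist (x i) (x j) = min 1 (δ * |(i : ℝ) - j|) := by
  obtain ⟨ψ, hψ, -⟩ := hU.exists_realization
    (fun i j : Fin (n + 1) => min 1 (δ * |((i : ℕ) : ℝ) - (j : ℕ)|)) (by simp)
    (fun i j => by rw [abs_sub_comm])
    (fun i j k => by
      have h0 : ∀ x y : ℝ, 0 ≤ δ * |x - y| := fun x y => mul_nonneg hδ (abs_nonneg _)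
      have h1 := mul_le_mul_of_nonneg_left
        (abs_sub_le ((i : ℕ) : ℝ) ((j : ℕ) : ℝ) ((k : ℕ) : ℝ)) hδ
      rw [mul_add] at h1
      have h2 := h0 (i : ℕ) (j : ℕ)
      have h3 := h0 (j : ℕ) (k : ℕ)
      rcases min_cases (1 : ℝ) (δ * |((i : ℕ) : ℝ) - (j : ℕ)|) with h | h <;>
        rcases min_cases (1 : ℝ) (δ * |((j : ℕ) : ℝ) - (k : ℕ)|) with h' | h' <;>
        rcases min_cases (1 : ℝ) (δ * |((i : ℕ) : ℝ) - (k : ℕ)|) with h'' | h'' <;> linarith)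
    (fun _ _ => min_le_left _ _) ∅ (fun _ => a) (by simp)
  refine ⟨fun i => ψ (Fin.ofNat (n + 1) i), fun i hi j hj => ?_⟩
  rw [hψ]
  simp only [Fin.ofNat]
  rw [Nat.mod_eq_of_lt (Nat.lt_succ_of_le hi), Nat.mod_eq_of_lt (Nat.lt_succ_of_le hj)]

/-- If `g` moves some point by at least `1 / n`, then a product of `n` conjugates of `g` moves some
point by distance `1`. -/
theorem IsBoundedUrysohnSpace.exists_isProdOfAtMostConj (hU : IsBoundedUrysohnSpace U) {n : ℕ}
    (hn : 1 ≤ n) {g : U ≃ᵢ U} (hg : ∃ a : U, 1 / (n : ℝ) ≤ dist a (g a)) :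
    ∃ k, IsProdOfAtMostConj g n k ∧ ∃ a, 1 ≤ dist a (k a) := by
  obtain ⟨a, ha⟩ := hg
  obtain ⟨x, hx⟩ := hU.exists_arithmetic_path a (dist_nonneg (x := a) (y := g a)) n
  have h : ∀ m ≤ n, ∃ k, IsProdOfAtMostConj g m k ∧ k (x 0) = x m := by
    intro m
    induction m with
    | zero => exact fun _ => ⟨1, ⟨[], by simp⟩, rfl⟩
    | succ m ih =>
      intro hm
      obtain ⟨k, hk, hkx⟩ := ih (by lia)
      have hd : dist (x m) (x (m + 1)) = dist a (g a) := by
        rw [hx m (by lia) (m + 1) hm]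
        simp [hU.dist_le_one]
      obtain ⟨c, hc⟩ := hU.exists_map_eq ![a, g a] ![x m, x (m + 1)] (by
        intro i j
        fin_cases i <;> fin_cases j <;> simp [hd, dist_comm (x (m + 1)), dist_comm (g a)])
      have h1 : IsProdOfAtMostConj g 1 (c * g * c⁻¹) :=
        ⟨[c * g * c⁻¹], le_rfl, fun y hy => Or.inl (isConj_iff.2 ⟨c, by simp_all⟩), by simp⟩
      refine ⟨c * g * c⁻¹ * k, (h1.mul hk).mono (by lia), ?_⟩
      rw [IsometryEquiv.mul_apply, hkx, IsometryEquiv.mul_apply, IsometryEquiv.mul_apply,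
        IsometryEquiv.inv_apply_of_apply_eq (show c a = x m from hc 0)]
      exact hc 1
  obtain ⟨k, hk, hkx⟩ := h n le_rfl
  refine ⟨k, hk, x 0, ?_⟩
  have hn' : (0 : ℝ) < n := by exact_mod_cast hn
  rw [hkx, hx 0 (by lia) n le_rfl]
  rw [div_le_iff₀ hn'] at ha
  simpa using ha

end

theorem mainTheorem3 {U : Type*} [MetricSpace U] (hU : IsBoundedUrysohnSpace U)
    (n : ℕ) (hn : 1 ≤ n) (g : U ≃ᵢ U) (hg : ∃ a : U, 1 / (n : ℝ) ≤ dist a (g a))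
    (f : U ≃ᵢ U) :
    IsProdOfAtMostConj g (n * 2 ^ 9) f := by
  obtain ⟨k, hk, hk'⟩ := hU.exists_isProdOfAtMostConj hn hg
  obtain ⟨p, q, h⟩ := hU.exists_pairQuot_eq hk' f
  rw [← mul_inv_eq_iff_eq_mul.2 h]
  -- Each quotient has six factors conjugate to `k` or `k⁻¹`, and 12n is at most 512n.
  exact ((hk.pairQuot p).mul (hk.pairQuot q).inv).mono (by lia)
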